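/- Let $n\ge 2$, let $(M^m,g)$ be a smooth Riemannian manifold, $(N^{2n},J,h)$ a Kähler manifold of real dimension $2n$, $V$ a smooth vector field on $M$, and $\varphi:M\to N$ a smooth submersion. Let $d\varphi_x^*:T_{\varphi(x)}N\to T_xM$ be the adjoint of $d\varphi_x$ with respect to $g$ and $h$, let $\nabla^M$ be the Levi-Civita connection of $M$, and call $v\in T_xM$ vertical if $d\varphi_x(v)=0$ and horizontal if it is orthogonal to $\ker d\varphi_x$. Suppose that $\varphi$ is pseudo-horizontally homothetic, that is, at every $x\in M$, $$ d\varphi_x\circ d\varphi_x^*\circ J=J\circ d\varphi_x\circ d\varphi_x^* ,\qquad d\varphi_x\big(\nabla^M_v\, d\varphi^*(JY)\big)=J\,d\varphi_x\big(\nabla^M_v\, d\varphi^*(Y)\big) $$ for every horizontal $v\in T_xM$ and every smooth vector field $Y$ defined on a neighbourhood of $\varphi(x)$. Then $\varphi$ is $V$-harmonic, i.e. $\operatorname{trace}\nabla d\varphi+d\varphi(V)=0$ on $M$, if and only if the fibres of $\varphi$ are $V$-minimal, i.e. for every $y\in N$, with $A$ the second fundamental form of the submanifold $\varphi^{-1}(y)$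 of $M$, the vector $\operatorname{trace}(A)-V$ is vertical at every point of $\varphi^{-1}(y)$. -/

import Mathlib

open Bundle Manifold
open scoped ContDiff

noncomputable section

namespace RiemannianGeometry
set_option linter.unusedSectionVars false

section LeviCivita

variable {E : Type*} [NormedAddCommGroup E] [NormedSpace ℝ E] [FiniteDimensional ℝ E]
  {H : Type*} [TopologicalSpace H] (I : ModelWithCorners ℝ E H)
  {M : Type*} [TopologicalSpace M] [ChartedSpace H M] [IsManifold I ∞ M]

instance finiteDimensional_tangentSpace (x : M) : FiniteDimensional ℝ (TangentSpace I x) :=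
  inferInstanceAs (FiniteDimensional ℝ E)

/-- Components of a tangent vector `w` at `p` in the coordinate frame of the preferred chart at `x`
(meaningful for `p` in the domain of that chart). -/
def toCoord (x : M) {p : M} (w : TangentSpace I p) : E :=
  (trivializationAt E (TangentSpace I) x).continuousLinearMapAt ℝ p w

/-- The tangent vector at `p` with components `e` in the coordinate frame of the preferred chart
at `x` (meaningful for `p` in the domain of that chart). -/
def ofCoord (x p : M) (e : E) : TangentSpace I p :=
  (trivializationAt E (TangentSpace I) x).symmL ℝ p e

/-- The vector field with value `a` at `x` whose components in the preferred chart at `x` are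
constant (meaningful near `x`). -/
def coordField {x : M} (a : TangentSpace I x) (p : M) : TangentSpace I p :=
  ofCoord I x p (toCoord I x a)

theorem ofCoord_toCoord {x p : M} (hp : p ∈ (trivializationAt E (TangentSpace I : M → Type _) x).baseSet)
    (a : TangentSpace I p) : ofCoord I x p (toCoord I x a) = a :=
  Bundle.Trivialization.symmL_continuousLinearMapAt _ hp a

theorem toCoord_ofCoord {x p : M} (hp : p ∈ (trivializationAt E (TangentSpace I : M → Type _) x).baseSet)
    (e : E) : toCoord I x (ofCoord I x p e) = e :=
  Bundle.Trivialization.continuousLinearMapAt_symmL _ hp e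

theorem coordField_self {x : M} (a : TangentSpace I x) : coordField I a x = a :=
  ofCoord_toCoord I (FiberBundle.mem_baseSet_trivializationAt' x) a

theorem coordField_eventuallyEq_extend {x : M} (a : TangentSpace I x) :
    ∀ᶠ p in nhds x, coordField I a p = FiberBundle.extend E a p := by
  filter_upwards [(trivializationAt E (TangentSpace I) x).open_baseSet.mem_nhds
    (FiberBundle.mem_baseSet_trivializationAt' x)] with p hp
  rw [coordField, toCoord, ofCoord, Bundle.Trivialization.continuousLinearMapAt_apply,
    Bundle.Trivialization.coe_linearMapAt_of_mem _ (FiberBundle.mem_baseSet_trivializationAt' x),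
    Bundle.Trivialization.symmL_apply _ hp]
  rfl

theorem toCoord_coordField {x : M} (a : TangentSpace I x) :
    ∀ᶠ p in nhds x, toCoord I x (coordField I a p) = toCoord I x a := by
  filter_upwards [(trivializationAt E (TangentSpace I) x).open_baseSet.mem_nhds
    (FiberBundle.mem_baseSet_trivializationAt' x)] with p hp
  exact toCoord_ofCoord I hp _

theorem mdifferentiableAt_toCoord {x : M} {Y : (p : M) → TangentSpace I p}
    (hY : MDifferentiableAt I (I.prod 𝓘(ℝ, E)) (fun p ↦ TotalSpace.mk' E p (Y p)) x) :
    MDifferentiableAt I 𝓘(ℝ, E) (fun p ↦ toCoord I x (Y p)) x := by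
  rw [mdifferentiableAt_section] at hY
  refine hY.congr_of_eventuallyEq ?_
  filter_upwards [(trivializationAt E (TangentSpace I) x).open_baseSet.mem_nhds
    (FiberBundle.mem_baseSet_trivializationAt' x)] with p hp
  rw [toCoord, Bundle.Trivialization.continuousLinearMapAt_apply,
    Bundle.Trivialization.coe_linearMapAt_of_mem _ hp]

theorem mdifferentiableAt_coordField {x : M} (a : TangentSpace I x) :
    MDifferentiableAt I (I.prod 𝓘(ℝ, E)) (fun p ↦ TotalSpace.mk' E p (coordField I a p)) x := by
  refine (FiberBundle.mdifferentiableAt_extend I E a).congr_of_eventuallyEq ?_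
  filter_upwards [coordField_eventuallyEq_extend I a] with p hp
  rw [hp]

variable [RiemannianBundle (fun x : M ↦ TangentSpace I x)]

/-- `∂_c g(a, b)` at `x`: the derivative in the direction `c` of the inner product of the
constant-component fields through `a` and `b`, in the preferred chart at `x`. -/
def metricDeriv {x : M} (a b c : TangentSpace I x) : ℝ :=
  mvfderiv I (fun p : M ↦ inner ℝ (coordField I a p) (coordField I b p)) x c

/-- The Christoffel symbols at `x` in the preferred chart at `x`, as the bilinear map
`a, b ↦ Γ(a, b)` with `g(Γ(a, b), c) = (∂_a g(b, c) + ∂_b g(a, c) - ∂_c g(a, b)) / 2`. -/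
def christoffel {x : M} (a b : TangentSpace I x) : TangentSpace I x :=
  ∑ j, ((metricDeriv I b (stdOrthonormalBasis ℝ (TangentSpace I x) j) a
    + metricDeriv I a (stdOrthonormalBasis ℝ (TangentSpace I x) j) b
    - metricDeriv I a b (stdOrthonormalBasis ℝ (TangentSpace I x) j)) / 2) •
      stdOrthonormalBasis ℝ (TangentSpace I x) j

section basics
variable [IsContMDiffRiemannianBundle I ∞ E (fun x : M ↦ TangentSpace I x)]


theorem coordField_add {x : M} (a b : TangentSpace I x) :
    coordField I (a + b) = coordField I a + coordField I b := by
  ext p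
  simp only [coordField, toCoord, ofCoord, Pi.add_apply, map_add]

theorem coordField_smul {x : M} (r : ℝ) (a : TangentSpace I x) :
    coordField I (r • a) = r • coordField I a := by
  ext p
  simp only [coordField, toCoord, ofCoord, Pi.smul_apply, map_smul]

theorem metricDeriv_comm {x : M} (a b c : TangentSpace I x) :
    metricDeriv I a b c = metricDeriv I b a c := by
  unfold metricDeriv; simp_rw [real_inner_comm]

theorem mdifferentiableAt_inner_coordField {x : M} (a b : TangentSpace I x) :
    MDifferentiableAt I 𝓘(ℝ) (fun p : M ↦ inner ℝ (coordField I a p) (coordField I b p)) x :=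
  MDifferentiableAt.inner_bundle (F := E) (E := fun p : M ↦ TangentSpace I p)
    (mdifferentiableAt_coordField I a) (mdifferentiableAt_coordField I b)

theorem metricDeriv_add_left {x : M} (a a' b c : TangentSpace I x) :
    metricDeriv I (a + a') b c = metricDeriv I a b c + metricDeriv I a' b c := by
  unfold metricDeriv
  simp only [coordField_add, Pi.add_apply, inner_add_left]
  rw [mvfderiv_fun_add (mdifferentiableAt_inner_coordField I a b) (mdifferentiableAt_inner_coordField I a' b)]
  rfl

theorem metricDeriv_smul_left {x : M} (r : ℝ) (a b c : TangentSpace I x) :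
    metricDeriv I (r • a) b c = r * metricDeriv I a b c := by
  unfold metricDeriv
  simp only [coordField_smul, Pi.smul_apply, inner_smul_left]
  rw [mvfderiv_fun_mul mdifferentiableAt_const (mdifferentiableAt_inner_coordField I a b)]
  simp [mvfderiv_const]

theorem metricDeriv_add_right {x : M} (a b b' c : TangentSpace I x) :
    metricDeriv I a (b + b') c = metricDeriv I a b c + metricDeriv I a b' c := by
  simp only [metricDeriv_comm I a, metricDeriv_add_left]

theorem metricDeriv_smul_right {x : M} (r : ℝ) (a b c : TangentSpace I x) :
    metricDeriv I a (r • b) c = r * metricDeriv I a b c := by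
  simp only [metricDeriv_comm I a, metricDeriv_smul_left]

theorem metricDeriv_add_dir {x : M} (a b c c' : TangentSpace I x) :
    metricDeriv I a b (c + c') = metricDeriv I a b c + metricDeriv I a b c' :=
  map_add _ _ _

theorem metricDeriv_smul_dir {x : M} (r : ℝ) (a b c : TangentSpace I x) :
    metricDeriv I a b (r • c) = r * metricDeriv I a b c :=
  map_smul _ _ _

theorem inner_christoffel {x : M} (a b c : TangentSpace I x) :
   inner ℝ (christoffel I a b) c =
     (metricDeriv I b c a + metricDeriv I a c b - metricDeriv I a b c) / 2 := by
  let f : TangentSpace I x →ₗ[ℝ] ℝ :=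
    { toFun := fun c ↦ (metricDeriv I b c a + metricDeriv I a c b - metricDeriv I a b c) / 2
      map_add' := fun c c' ↦ by
        simp only [metricDeriv_add_right, metricDeriv_add_dir]; ring
      map_smul' := fun r c ↦ by
        simp only [metricDeriv_smul_right, metricDeriv_smul_dir, RingHom.id_apply, smul_eq_mul]
        ring }
  have h : f c = f (∑ j, inner ℝ (stdOrthonormalBasis ℝ (TangentSpace I x) j) c •
      stdOrthonormalBasis ℝ (TangentSpace I x) j) := by
    rw [OrthonormalBasis.sum_repr']
  change _ = f c
  rw [h, map_sum, christoffel, sum_inner]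
  refine Finset.sum_congr rfl fun j _ ↦ ?_
  rw [map_smul, real_inner_smul_left, smul_eq_mul, mul_comm]
  rfl

theorem christoffel_comm {x : M} (a b : TangentSpace I x) :
    christoffel I a b = christoffel I b a := by
  refine ext_inner_right ℝ fun c ↦ ?_
  rw [inner_christoffel, inner_christoffel, metricDeriv_comm I a b]
  ring

theorem christoffel_add_right {x : M} (a b b' : TangentSpace I x) :
    christoffel I a (b + b') = christoffel I a b + christoffel I a b' := by
  refine ext_inner_right ℝ fun c ↦ ?_
  simp only [inner_add_left, inner_christoffel, metricDeriv_add_left, metricDeriv_add_right,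
    metricDeriv_add_dir]
  ring

theorem christoffel_smul_right {x : M} (r : ℝ) (a b : TangentSpace I x) :
    christoffel I a (r • b) = r • christoffel I a b := by
  refine ext_inner_right ℝ fun c ↦ ?_
  simp only [real_inner_smul_left, inner_christoffel, metricDeriv_smul_left,
    metricDeriv_smul_right, metricDeriv_smul_dir]
  ring

/-- `christoffel` as a linear map in the direction of differentiation. -/
def christoffelMap {x : M} (b : TangentSpace I x) : TangentSpace I x →L[ℝ] TangentSpace I x :=
  LinearMap.toContinuousLinearMap
    { toFun := fun a ↦ christoffel I a b
      map_add' := fun a a' ↦ by simp only [christoffel_comm I _ b, christoffel_add_right]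
      map_smul' := fun r a ↦ by
        simp only [christoffel_comm I _ b, christoffel_smul_right, RingHom.id_apply] }

/-- The Levi-Civita connection of a Riemannian manifold: `leviCivita I Y x v` is `(∇_v Y)(x)`, which
in the preferred chart at `x` is `D Y (v) + Γ(v, Y)`. It is torsion-free and compatible with the
metric, see `leviCivita_torsion` and `leviCivita_isMetricCompatible`. -/
def leviCivita : CovariantDerivative I E (TangentSpace I : M → Type _) where
  toFun Y x := (trivializationAt E (TangentSpace I) x).symmL ℝ x ∘L
      mvfderiv I (fun p ↦ toCoord I x (Y p)) x + christoffelMap I (Y x)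
  isCovariantDerivativeOnUniv :=
    { add := by
        intro Y Z x hY hZ _
        have h : (fun p ↦ toCoord I x ((Y + Z) p)) =
            (fun p ↦ toCoord I x (Y p)) + fun p ↦ toCoord I x (Z p) := by
          ext1 p
          simp only [toCoord, Pi.add_apply, map_add]
        rw [h, mvfderiv_add (mdifferentiableAt_toCoord I hY) (mdifferentiableAt_toCoord I hZ)]
        ext v
        simp [christoffelMap, christoffel_add_right]
        abel
      leibniz := by
        intro Y f x hY hf _
        have h : (fun p ↦ toCoord I x ((f • Y) p)) = f • fun p ↦ toCoord I x (Y p) := by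
          ext1 p
          simp only [toCoord, Pi.smul_apply', map_smul]
        rw [h, mvfderiv_smul hf (mdifferentiableAt_toCoord I hY)]
        ext v
        have e := ofCoord_toCoord I (FiberBundle.mem_baseSet_trivializationAt' x) (Y x)
        have e' : christoffelMap I ((f • Y) x) v = f x • christoffelMap I (Y x) v :=
          christoffel_smul_right I (f x) v (Y x)
        rw [ofCoord] at e
        simp only [_root_.add_apply, ContinuousLinearMap.comp_apply,
          _root_.smul_apply, ContinuousLinearMap.smulRight_apply, map_add, map_smul,
          e, e', smul_add]
        abel }

theorem leviCivita_apply (Y : (p : M) → TangentSpace I p) (x : M) (v : TangentSpace I x) :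
    leviCivita I Y x v =
      ofCoord I x x (mvfderiv I (fun p ↦ toCoord I x (Y p)) x v) + christoffel I v (Y x) := rfl

theorem leviCivita_coordField {x : M} (v a : TangentSpace I x) :
    leviCivita I (coordField I a) x v = christoffel I v a := by
  have h : mfderiv I 𝓘(ℝ, E) (fun p ↦ toCoord I x (coordField I a p)) x = 0 := by
    rw [Filter.EventuallyEq.mfderiv_eq (toCoord_coordField I a)]
    exact mfderiv_const
  rw [leviCivita_apply, coordField_self, mvfderiv, h]
  simp [ofCoord, -Bundle.Trivialization.symmL_apply]

theorem mlieBracket_coordField {x : M} (a b : TangentSpace I x) :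
    VectorField.mlieBracket I (coordField I a) (coordField I b) x = 0 := by
  have h (c : TangentSpace I x) :
      VectorField.mpullbackWithin 𝓘(ℝ, E) I (extChartAt I x).symm (coordField I c) (Set.range I)
        =ᶠ[nhdsWithin (extChartAt I x x) (Set.range I)] fun _ ↦ toCoord I x c := by
    filter_upwards [extChartAt_target_mem_nhdsWithin x] with u hu
    have hu' : (extChartAt I x).symm u ∈ (chartAt H x).source := by
      rw [← extChartAt_source I]; exact (extChartAt I x).map_target hu
    have e := TangentBundle.symmL_trivializationAt (I := I) hu'
    rw [(extChartAt I x).right_inv hu] at e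
    have hi := isInvertible_mfderivWithin_extChartAt_symm (I := I) hu
    change (mfderivWithin 𝓘(ℝ, E) I (extChartAt I x).symm (Set.range I) u).inverse
      ((trivializationAt E (TangentSpace I) x).symmL ℝ ((extChartAt I x).symm u)
        (toCoord I x c)) = toCoord I x c
    rw [e]
    exact hi.inverse_apply_eq.2 rfl
  have hL (A B : E → E) (a b : E) (hA : A =ᶠ[nhdsWithin (extChartAt I x x) (Set.range I)] fun _ ↦ a)
      (hB : B =ᶠ[nhdsWithin (extChartAt I x x) (Set.range I)] fun _ ↦ b) :
      VectorField.lieBracketWithin ℝ A B (Set.range I) (extChartAt I x x) = 0 := by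
    have hm : extChartAt I x x ∈ Set.range I := mem_extChartAt_target x |> fun h ↦
      extChartAt_target_subset_range x h
    rw [VectorField.lieBracketWithin_eq]
    dsimp only
    rw [hA.fderivWithin_eq_of_mem hm, hB.fderivWithin_eq_of_mem hm]
    simp
  rw [← VectorField.mlieBracketWithin_univ, VectorField.mlieBracketWithin_apply, Set.preimage_univ,
    Set.univ_inter]
  exact (congrArg _ (hL _ _ _ _ (h a) (h b))).trans (map_zero _)

theorem leviCivita_torsion : (leviCivita I (M := M)).torsion = 0 := by
  ext x v w
  have h := (leviCivita I (M := M)).torsion_apply (mdifferentiableAt_coordField I v)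
    (mdifferentiableAt_coordField I w)
  simp only [coordField_self, leviCivita_coordField, mlieBracket_coordField] at h
  rw [h, christoffel_comm I v w]
  simp

theorem leviCivita_isMetricCompatible :
    CovariantDerivative.IsMetricCompatible (I := I) (V := fun x : M ↦ TangentSpace I x)
      (leviCivita I (M := M)) := by
  refine funext fun x ↦ ?_
  ext a b v
  have h := CovariantDerivative.derivMetricTensor_apply (I := I)
      (V := fun x : M ↦ TangentSpace I x) (leviCivita I (M := M)) x (X := coordField I v)
      (mdifferentiableAt_coordField I a) (mdifferentiableAt_coordField I b)
  simp only [coordField_self, leviCivita_coordField] at h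
  rw [h, inner_christoffel, real_inner_comm, inner_christoffel]
  change metricDeriv I a b v - _ - _ = 0
  rw [metricDeriv_comm I v b, metricDeriv_comm I v a, metricDeriv_comm I b a]
  ring

end basics

end LeviCivita

section Maps

variable {E : Type*} [NormedAddCommGroup E] [NormedSpace ℝ E] [FiniteDimensional ℝ E]
  {H : Type*} [TopologicalSpace H] (I : ModelWithCorners ℝ E H)
  {M : Type*} [TopologicalSpace M] [ChartedSpace H M] [IsManifold I ∞ M]
  [RiemannianBundle (fun x : M ↦ TangentSpace I x)]
  [IsContMDiffRiemannianBundle I ∞ E (fun x : M ↦ TangentSpace I x)]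
  {E' : Type*} [NormedAddCommGroup E'] [NormedSpace ℝ E'] [FiniteDimensional ℝ E']
  {H' : Type*} [TopologicalSpace H'] (I' : ModelWithCorners ℝ E' H')
  {N : Type*} [TopologicalSpace N] [ChartedSpace H' N] [IsManifold I' ∞ N]
  [RiemannianBundle (fun y : N ↦ TangentSpace I' y)]
  [IsContMDiffRiemannianBundle I' ∞ E' (fun y : N ↦ TangentSpace I' y)]

/-- The connection `∇^φ` on the pull-back bundle `φ⁻¹TN` induced by the Levi-Civita connection of `N`:
`covDerivAlong I I' φ S x v` is `(∇^φ_v S)(x)` for a section `S` of `φ⁻¹TN`. -/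
def covDerivAlong (φ : M → N) (S : (p : M) → TangentSpace I' (φ p)) (x : M)
    (v : TangentSpace I x) : TangentSpace I' (φ x) :=
  ofCoord I' (φ x) (φ x) (mvfderiv I (fun p ↦ toCoord I' (φ x) (S p)) x v)
    + christoffel I' (mfderiv I I' φ x v) (S x)

/-- `∇^φ_v (Y ∘ φ) = ∇_{dφ(v)} Y` for a vector field `Y` on `N`. -/
theorem covDerivAlong_comp {φ : M → N} {x : M} (hφ : MDifferentiableAt I I' φ x)
    {Y : (y : N) → TangentSpace I' y}
    (hY : MDifferentiableAt I' (I'.prod 𝓘(ℝ, E')) (fun y ↦ TotalSpace.mk' E' y (Y y)) (φ x))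
    (v : TangentSpace I x) :
    covDerivAlong I I' φ (fun p ↦ Y (φ p)) x v = leviCivita I' Y (φ x) (mfderiv I I' φ x v) := by
  rw [covDerivAlong, leviCivita_apply]
  congr 2
  have := mfderiv_comp x (mdifferentiableAt_toCoord I' hY) hφ
  exact congrArg (fun L ↦ L v) this

/-- The second fundamental form `∇dφ` of a map, `(v, w) ↦ ∇^φ_v (dφ(W)) - dφ(∇_v W)`, where `W` is a
vector field extending `w`. -/
def secondFundamentalForm (φ : M → N) (x : M) (v w : TangentSpace I x) : TangentSpace I' (φ x) :=
  covDerivAlong I I' φ (fun p ↦ mfderiv I I' φ p (coordField I w p)) x v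
    - mfderiv I I' φ x (leviCivita I (coordField I w) x v)

/-- The tension field `τ(φ) = trace ∇dφ`. -/
def tensionField (φ : M → N) (x : M) : TangentSpace I' (φ x) :=
  ∑ i, secondFundamentalForm I I' φ x (stdOrthonormalBasis ℝ (TangentSpace I x) i)
    (stdOrthonormalBasis ℝ (TangentSpace I x) i)

/-- `φ` is `V`-harmonic: `τ(φ) + dφ(V) = 0`. -/
def IsVHarmonic (V : (x : M) → TangentSpace I x) (φ : M → N) : Prop :=
  ∀ x, tensionField I I' φ x + mfderiv I I' φ x (V x) = 0

/-- The adjoint `dφ_x^* : T_{φ x} N → T_x M` of the differential. -/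
def adjointDifferential (φ : M → N) (x : M) : TangentSpace I' (φ x) →ₗ[ℝ] TangentSpace I x :=
  LinearMap.adjoint (mfderiv I I' φ x : TangentSpace I x →ₗ[ℝ] TangentSpace I' (φ x))

/-- The vertical space `ker dφ_x`; its orthogonal complement is the horizontal space. -/
def verticalSpace (φ : M → N) (x : M) : Submodule ℝ (TangentSpace I x) :=
  LinearMap.ker (mfderiv I I' φ x : TangentSpace I x →ₗ[ℝ] TangentSpace I' (φ x))

/-- Pseudo-horizontally weakly conformal at `x`: `dφ_x ∘ dφ_x^*` commutes with `J`. -/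
def IsPHWCAt (J : (y : N) → TangentSpace I' y →L[ℝ] TangentSpace I' y) (φ : M → N) (x : M) :
    Prop :=
  ∀ w : TangentSpace I' (φ x),
    mfderiv I I' φ x (adjointDifferential I I' φ x (J (φ x) w)) =
      J (φ x) (mfderiv I I' φ x (adjointDifferential I I' φ x w))

/-- Pseudo-horizontally homothetic at `x`: PHWC at `x`, and
`dφ (∇_v dφ^*(JY)) = J dφ (∇_v dφ^*(Y))` at `x` for all horizontal `v` at `x` and all smooth vector
fields `Y` defined on a neighbourhood `U` of `φ x` (values of `Y` outside `U` play no role). -/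
def IsPHHAt (J : (y : N) → TangentSpace I' y →L[ℝ] TangentSpace I' y) (φ : M → N) (x : M) :
    Prop :=
  IsPHWCAt I I' J φ x ∧
    ∀ v ∈ (verticalSpace I I' φ x)ᗮ, ∀ U : Set N, IsOpen U → φ x ∈ U →
      ∀ Y : (y : N) → TangentSpace I' y,
        ContMDiffOn I' (I'.prod 𝓘(ℝ, E')) ∞ (fun y ↦ TotalSpace.mk' E' y (Y y)) U →
          mfderiv I I' φ x
            (leviCivita I (fun p ↦ adjointDifferential I I' φ p (J (φ p) (Y (φ p)))) x v) =
          J (φ x) (mfderiv I I' φ x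
            (leviCivita I (fun p ↦ adjointDifferential I I' φ p (Y (φ p))) x v))

/-- The almost complex structure `J` makes the Riemannian manifold `N` a Kähler manifold: `J` is
smooth, orthogonal and parallel for the Levi-Civita connection. -/
structure IsKahler (J : (y : N) → TangentSpace I' y →L[ℝ] TangentSpace I' y) : Prop where
  smooth : ContMDiff I' (I'.prod 𝓘(ℝ, E' →L[ℝ] E')) ∞
    (fun y ↦ TotalSpace.mk' (E' →L[ℝ] E')
      (E := fun y : N ↦ TangentSpace I' y →L[ℝ] TangentSpace I' y) y (J y))
  sq : ∀ (y : N) (v : TangentSpace I' y), J y (J y v) = -v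
  inner_map : ∀ (y : N) (v w : TangentSpace I' y), inner ℝ (J y v) (J y w) = inner ℝ v w
  parallel : ∀ (y : N) (U : Set N), IsOpen U → y ∈ U → ∀ Y : (y : N) → TangentSpace I' y,
    ContMDiffOn I' (I'.prod 𝓘(ℝ, E')) ∞ (fun y ↦ TotalSpace.mk' E' y (Y y)) U →
      ∀ v : TangentSpace I' y, leviCivita I' (fun q ↦ J q (Y q)) y v = J y (leviCivita I' Y y v)

/-- A vertical vector field extending the vertical vector `u`: the pointwise orthogonal projection of
an extension of `u` to the vertical spaces. It is smooth near `x` when `φ` is a submersion. -/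
def verticalField (φ : M → N) {x : M} (u : TangentSpace I x) (p : M) : TangentSpace I p :=
  (verticalSpace I I' φ p).starProjection (coordField I u p)

/-- The second fundamental form `A(u, w) = (∇_u W)^⊥` at `x` of the fibre of the submersion `φ` through
`x`, where `W` is a vector field extending `w` which is tangent to the fibres. The tangent space of
the fibre at `x` is the vertical space. -/
def fibreSecondFundamentalForm (φ : M → N) (x : M) (u w : verticalSpace I I' φ x) :
    TangentSpace I x :=
  (verticalSpace I I' φ x)ᗮ.starProjection
    (leviCivita I (verticalField I I' φ (w : TangentSpace I x)) x (u : TangentSpace I x))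

/-- The fibre `φ⁻¹(y)` of the submersion `φ` is `V`-minimal: at each of its points, `trace A - V` is
tangent to the fibre. The trace is taken over the tangent space of the fibre. -/
def IsVMinimalFibre (V : (x : M) → TangentSpace I x) (φ : M → N) (y : N) : Prop :=
  ∀ x : M, φ x = y →
    ∑ i, fibreSecondFundamentalForm I I' φ x
        (stdOrthonormalBasis ℝ (verticalSpace I I' φ x) i)
        (stdOrthonormalBasis ℝ (verticalSpace I I' φ x) i) - V x ∈ verticalSpace I I' φ x

end Maps
end RiemannianGeometry

end

noncomputable section

namespace RiemannianGeometry

section LinearAlgebra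

open Module

variable {T : Type*} [NormedAddCommGroup T] [InnerProductSpace ℝ T] [FiniteDimensional ℝ T]
  {G : Type*} [AddCommGroup G] [Module ℝ G]

theorem sum_bilin_starProjection {κ ι : Type*} [Fintype κ] [Fintype ι] (B : T →ₗ[ℝ] T →ₗ[ℝ] G)
    (e : OrthonormalBasis κ ℝ T) (K : Submodule ℝ T) (f : OrthonormalBasis ι ℝ K) :
    ∑ i, B (K.starProjection (e i)) (e i) = ∑ j, B (f j) (f j) := by
  have h (w : T) : K.starProjection w = ∑ j, inner ℝ (f j : T) w • (f j : T) := by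
    rw [Submodule.starProjection_apply, ← f.sum_repr' (K.orthogonalProjectionOnto w)]
    simp
  calc ∑ i, B (K.starProjection (e i)) (e i)
      = ∑ j, ∑ i, inner ℝ (f j : T) (e i) • B (f j) (e i) := by
        simp_rw [h, map_sum, LinearMap.sum_apply, map_smul, LinearMap.smul_apply]
        exact Finset.sum_comm
    _ = ∑ j, B (f j) (∑ i, inner ℝ (e i) (f j : T) • e i) := by
        simp_rw [map_sum, map_smul, real_inner_comm]
    _ = ∑ j, B (f j) (f j) := by simp_rw [e.sum_repr']

/-- The trace of a bilinear map splits into the traces over a subspace and its complement. -/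
theorem sum_bilin_eq_add {κ ι ι' : Type*} [Fintype κ] [Fintype ι] [Fintype ι']
    (B : T →ₗ[ℝ] T →ₗ[ℝ] G) (e : OrthonormalBasis κ ℝ T) (K : Submodule ℝ T)
    (f : OrthonormalBasis ι ℝ K) (f' : OrthonormalBasis ι' ℝ Kᗮ) :
    ∑ i, B (e i) (e i) = ∑ j, B (f j) (f j) + ∑ j, B (f' j) (f' j) := by
  rw [← sum_bilin_starProjection B e K f, ← sum_bilin_starProjection B e Kᗮ f',
    ← Finset.sum_add_distrib]
  refine Finset.sum_congr rfl fun i _ ↦ ?_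
  rw [← LinearMap.add_apply, ← map_add, Submodule.starProjection_add_starProjection_orthogonal]

/-- If `K ≃ F` carries a linear isometry `A y ↦ A (J y)` under which the quadratic form of `B`
changes sign, the trace of `B` over `K` vanishes. -/
theorem sum_bilin_eq_zero {F ι : Type*} [Fintype ι] [AddCommGroup F] [Module ℝ F]
    (B : T →ₗ[ℝ] T →ₗ[ℝ] G) (K : Submodule ℝ T) (f : OrthonormalBasis ι ℝ K)
    (A : F →ₗ[ℝ] T) (hA : LinearMap.range A = K) (J : F → F)
    (hJ : ∀ y z, inner ℝ (A (J y)) (A (J z)) = inner ℝ (A y) (A z))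
    (hB : ∀ y, B (A (J y)) (A (J y)) = -B (A y) (A y)) :
    ∑ j, B (f j) (f j) = 0 := by
  classical
  have hf (j : ι) : ∃ y, A y = f j := LinearMap.mem_range.1 (hA.ge (f j).2)
  choose y hy using hf
  let g (j : ι) : K := ⟨A (J (y j)), hA ▸ LinearMap.mem_range_self A _⟩
  have hg : Orthonormal ℝ g := by
    rw [orthonormal_iff_ite]
    intro i j
    change inner ℝ (A (J (y i))) (A (J (y j))) = _
    rw [hJ, hy, hy, ← orthonormal_iff_ite.1 f.orthonormal i j]
    rfl
  have hs : ⊤ ≤ Submodule.span ℝ (Set.range g) :=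
    (hg.linearIndependent.span_eq_top_of_card_eq_finrank'
      (finrank_eq_card_basis f.toBasis).symm).ge
  let g' := OrthonormalBasis.mk hg hs
  have h1 := sum_bilin_starProjection B (stdOrthonormalBasis ℝ T) K f
  have h2 := sum_bilin_starProjection B (stdOrthonormalBasis ℝ T) K g'
  have h3 : ∑ j, B (g' j) (g' j) = -∑ j, B (f j) (f j) := by
    rw [← Finset.sum_neg_distrib]
    refine Finset.sum_congr rfl fun j _ ↦ ?_
    simp only [g', OrthonormalBasis.coe_mk, g, hB, hy]
  rw [← h2, h1] at h3
  have h4 : (2 : ℝ) • ∑ j, B (f j) (f j) = 0 := by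
    rw [two_smul]
    exact eq_neg_iff_add_eq_zero.1 h3
  exact (smul_eq_zero.1 h4).resolve_left two_ne_zero

end LinearAlgebra

section Frames

set_option linter.unusedSectionVars false

variable {E : Type*} [NormedAddCommGroup E] [NormedSpace ℝ E] [FiniteDimensional ℝ E]
  {H : Type*} [TopologicalSpace H] (I : ModelWithCorners ℝ E H)
  {M : Type*} [TopologicalSpace M] [ChartedSpace H M] [IsManifold I ∞ M]

theorem coordField_sum {ι : Type*} (s : Finset ι) {x : M} (a : ι → TangentSpace I x) (p : M) :
    coordField I (∑ i ∈ s, a i) p = ∑ i ∈ s, coordField I (a i) p := by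
  simp only [coordField, toCoord, ofCoord, map_sum]

theorem coordField_ofCoord_toCoord {x p : M}
    (hp : p ∈ (trivializationAt E (TangentSpace I : M → Type _) x).baseSet)
    (w : TangentSpace I p) : coordField I (ofCoord I x x (toCoord I x w)) p = w := by
  rw [coordField, toCoord_ofCoord I (FiberBundle.mem_baseSet_trivializationAt' x),
    ofCoord_toCoord I hp]

theorem eq_sum_coordField {ι : Type*} [Fintype ι] {x p : M}
    (hp : p ∈ (trivializationAt E (TangentSpace I : M → Type _) x).baseSet)
    (b : Module.Basis ι ℝ (TangentSpace I x)) (w : TangentSpace I p) :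
    w = ∑ i, b.repr (ofCoord I x x (toCoord I x w)) i • coordField I (b i) p := by
  conv_lhs => rw [← coordField_ofCoord_toCoord I hp w, ← b.sum_repr (ofCoord I x x (toCoord I x w))]
  rw [coordField_sum]
  refine Finset.sum_congr rfl fun i _ ↦ ?_
  simp only [coordField, toCoord, ofCoord, map_smul]

theorem contMDiffOn_coordField {x : M} (a : TangentSpace I x) :
    ContMDiffOn I (I.prod 𝓘(ℝ, E)) ∞ (fun p ↦ TotalSpace.mk' E p (coordField I a p))
      (trivializationAt E (TangentSpace I : M → Type _) x).baseSet := by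
  rw [Bundle.Trivialization.contMDiffOn_section_baseSet_iff]
  refine (contMDiffOn_const (c := toCoord I x a)).congr fun p hp ↦ ?_
  rw [← toCoord_ofCoord I hp (toCoord I x a), toCoord,
    Bundle.Trivialization.continuousLinearMapAt_apply,
    Bundle.Trivialization.coe_linearMapAt_of_mem _ hp]
  rfl

end Frames

section Gram

variable {EM : Type*} [NormedAddCommGroup EM] [NormedSpace ℝ EM]
  {H : Type*} [TopologicalSpace H] {I : ModelWithCorners ℝ EM H}
  {M : Type*} [TopologicalSpace M] [ChartedSpace H M]

theorem mdifferentiableAt_det {ι : Type} [Fintype ι] [DecidableEq ι] {A : M → Matrix ι ι ℝ} {x : M}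
    (hA : ∀ i j, MDifferentiableAt I 𝓘(ℝ) (fun p ↦ A p i j) x) :
    MDifferentiableAt I 𝓘(ℝ) (fun p ↦ (A p).det) x := by
  have h : (fun p ↦ (A p).det) = ∑ σ : Equiv.Perm ι, (fun _ ↦ ((Equiv.Perm.sign σ : ℤ) : ℝ)) *
      ∏ i, fun p ↦ A p (σ i) i := by
    ext p
    simp [Matrix.det_apply']
  rw [h]
  exact MDifferentiableAt.sum fun σ _ ↦
    mdifferentiableAt_const.mul (MDifferentiableAt.prod fun i _ ↦ hA _ _)

/-- A section which near `x` is a combination of differentiable sections `Z i`, linearly independent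
at `x`, is differentiable at `x` as soon as its inner products with the `Z i` are. -/
theorem mdifferentiableAt_of_inner {F : Type*} [NormedAddCommGroup F] [NormedSpace ℝ F]
    {V : M → Type*} [TopologicalSpace (TotalSpace F V)] [∀ p, NormedAddCommGroup (V p)]
    [∀ p, InnerProductSpace ℝ (V p)] [FiberBundle F V] [VectorBundle ℝ F V]
    [IsManifold I 1 M] [ContMDiffVectorBundle 1 F V I] [IsContMDiffRiemannianBundle I 1 F V]
    {ι : Type} [Fintype ι] {Z : ι → (p : M) → V p} {X : (p : M) → V p} {x : M}
    (hZ : ∀ i, MDifferentiableAt I (I.prod 𝓘(ℝ, F)) (fun p ↦ TotalSpace.mk' F p (Z i p)) x)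
    (hli : LinearIndependent ℝ fun i ↦ Z i x)
    (hspan : ∀ᶠ p in nhds x, X p ∈ Submodule.span ℝ (Set.range fun i ↦ Z i p))
    (hX : ∀ i, MDifferentiableAt I 𝓘(ℝ) (fun p ↦ inner ℝ (Z i p) (X p)) x) :
    MDifferentiableAt I (I.prod 𝓘(ℝ, F)) (fun p ↦ TotalSpace.mk' F p (X p)) x := by
  classical
  let A (p : M) : Matrix ι ι ℝ := Matrix.gram ℝ fun i ↦ Z i p
  have hA (i j) : MDifferentiableAt I 𝓘(ℝ) (fun p ↦ A p i j) x :=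
    MDifferentiableAt.inner_bundle (F := F) (hZ i) (hZ j)
  let b (p : M) (i : ι) : ℝ := inner ℝ (Z i p) (X p)
  have hdet : (A x).det ≠ 0 := Matrix.det_gram_ne_zero_iff_linearIndependent.2 hli
  have hAd := mdifferentiableAt_det hA
  have hdet' : ∀ᶠ p in nhds x, (A p).det ≠ 0 := hAd.continuousAt.eventually_ne hdet
  let c (j : ι) (p : M) : ℝ := (A p).det⁻¹ * (A p).cramer (b p) j
  have hc (j) : MDifferentiableAt I 𝓘(ℝ) (c j) x := by
    refine MDifferentiableAt.mul ?_ ?_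
    · exact (differentiableAt_inv hdet).mdifferentiableAt.comp x hAd
    · simp_rw [Matrix.cramer_apply]
      refine mdifferentiableAt_det fun i k ↦ ?_
      rcases eq_or_ne k j with rfl | hk
      · simpa [b] using hX i
      · simpa [Matrix.updateCol_apply, hk] using hA i k
  have hsum : MDifferentiableAt I (I.prod 𝓘(ℝ, F))
      (fun p ↦ TotalSpace.mk' F p (∑ j, c j p • Z j p)) x :=
    MDifferentiableAt.sum_section fun j _ ↦ (hc j).smul_section (hZ j)
  refine hsum.congr_of_eventuallyEq ?_
  filter_upwards [hspan, hdet'] with p hp hpd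
  congr 1
  obtain ⟨d, hd⟩ := (Submodule.mem_span_range_iff_exists_fun ℝ).1 hp
  have hb : b p = (A p).mulVec d := by
    ext i
    simp only [b, ← hd, inner_sum, Matrix.mulVec, dotProduct, A, Matrix.gram_apply,
      real_inner_smul_right]
    exact Finset.sum_congr rfl fun j _ ↦ mul_comm _ _
  rw [← hd]
  refine Finset.sum_congr rfl fun j _ ↦ ?_
  congr 1
  change d j = (A p).det⁻¹ * (A p).cramer (b p) j
  rw [hb, Matrix.cramer_eq_adjugate_mulVec, Matrix.mulVec_mulVec, Matrix.adjugate_mul,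
    Matrix.smul_mulVec, Matrix.one_mulVec, Pi.smul_apply, smul_eq_mul, inv_mul_cancel_left₀ hpd]

end Gram

section Differentiability

set_option linter.unusedSectionVars false

variable {E : Type*} [NormedAddCommGroup E] [NormedSpace ℝ E] [FiniteDimensional ℝ E]
  {H : Type*} [TopologicalSpace H] {I : ModelWithCorners ℝ E H}
  {M : Type*} [TopologicalSpace M] [ChartedSpace H M] [IsManifold I ∞ M]
  {E' : Type*} [NormedAddCommGroup E'] [NormedSpace ℝ E'] [FiniteDimensional ℝ E']
  {H' : Type*} [TopologicalSpace H'] {I' : ModelWithCorners ℝ E' H'}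
  {N : Type*} [TopologicalSpace N] [ChartedSpace H' N] [IsManifold I' ∞ N]

theorem mdifferentiableAt_toCoord_along {φ : M → N} {S : (p : M) → TangentSpace I' (φ p)} {x : M}
    (hS : MDifferentiableAt I (I'.prod 𝓘(ℝ, E')) (fun p ↦ TotalSpace.mk' E' (φ p) (S p)) x) :
    MDifferentiableAt I 𝓘(ℝ, E') (fun p ↦ toCoord I' (φ x) (S p)) x := by
  rw [mdifferentiableAt_totalSpace] at hS
  refine hS.2.congr_of_eventuallyEq ?_
  filter_upwards [hS.1.continuousAt.preimage_mem_nhds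
    ((trivializationAt E' (TangentSpace I') (φ x)).open_baseSet.mem_nhds
    (FiberBundle.mem_baseSet_trivializationAt' (φ x)))] with p hp
  rw [toCoord, Bundle.Trivialization.continuousLinearMapAt_apply,
    Bundle.Trivialization.coe_linearMapAt_of_mem _ hp]

theorem mdifferentiableAt_mfderiv_apply {φ : M → N} (hφ : ContMDiff I I' ∞ φ)
    {W : (p : M) → TangentSpace I p} {x : M}
    (hW : MDifferentiableAt I (I.prod 𝓘(ℝ, E)) (fun p ↦ TotalSpace.mk' E p (W p)) x) :
    MDifferentiableAt I (I'.prod 𝓘(ℝ, E'))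
      (fun p ↦ TotalSpace.mk' E' (φ p) (mfderiv I I' φ p (W p))) x := by
  have h := (hφ.contMDiff_tangentMap (m := ∞) le_rfl).mdifferentiable (by simp)
  exact MDifferentiableAt.comp x (h ⟨x, W x⟩) hW

variable [RiemannianBundle (fun x : M ↦ TangentSpace I x)]
  [IsContMDiffRiemannianBundle I ∞ E (fun x : M ↦ TangentSpace I x)]
  [RiemannianBundle (fun y : N ↦ TangentSpace I' y)]
  [IsContMDiffRiemannianBundle I' ∞ E' (fun y : N ↦ TangentSpace I' y)]

theorem inner_adjointDifferential (φ : M → N) (x : M) (v : TangentSpace I x)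
    (w : TangentSpace I' (φ x)) :
    inner ℝ v (adjointDifferential I I' φ x w) = inner ℝ (mfderiv I I' φ x v) w :=
  LinearMap.adjoint_inner_right _ _ _

theorem range_adjointDifferential (φ : M → N) (x : M) :
    LinearMap.range (adjointDifferential I I' φ x) = (verticalSpace I I' φ x)ᗮ :=
  (LinearMap.orthogonal_ker _).symm

theorem injective_adjointDifferential {φ : M → N} {x : M}
    (hφ : Function.Surjective (mfderiv I I' φ x)) :
    Function.Injective (adjointDifferential I I' φ x) := by
  rw [injective_iff_map_eq_zero]
  intro w hw
  obtain ⟨v, rfl⟩ := hφ w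
  rw [← inner_self_eq_zero (𝕜 := ℝ), ← inner_adjointDifferential, hw, inner_zero_right]

theorem mdifferentiableAt_adjointDifferential {φ : M → N} (hφ : ContMDiff I I' ∞ φ)
    {S : (p : M) → TangentSpace I' (φ p)} {x : M}
    (hS : MDifferentiableAt I (I'.prod 𝓘(ℝ, E')) (fun p ↦ TotalSpace.mk' E' (φ p) (S p)) x) :
    MDifferentiableAt I (I.prod 𝓘(ℝ, E))
      (fun p ↦ TotalSpace.mk' E p (adjointDifferential I I' φ p (S p))) x := by
  let b := Module.finBasis ℝ (TangentSpace I x)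
  refine mdifferentiableAt_of_inner (I := I) (F := E) (V := fun p : M ↦ TangentSpace I p)
    (Z := fun i p ↦ coordField I (b i) p) (fun i ↦ mdifferentiableAt_coordField I (b i)) ?_ ?_ ?_
  · simpa only [coordField_self] using b.linearIndependent
  · filter_upwards [(trivializationAt E (TangentSpace I) x).open_baseSet.mem_nhds
      (FiberBundle.mem_baseSet_trivializationAt' x)] with p hp
    rw [eq_sum_coordField I hp b (adjointDifferential I I' φ p (S p))]
    exact Submodule.sum_mem _ fun i _ ↦ Submodule.smul_mem _ _ (Submodule.subset_span ⟨i, rfl⟩)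
  · intro i
    simp_rw [inner_adjointDifferential]
    exact MDifferentiableAt.inner_bundle (F := E') (E := fun y : N ↦ TangentSpace I' y)
      (mdifferentiableAt_mfderiv_apply hφ (mdifferentiableAt_coordField I (b i))) hS

theorem mdifferentiableAt_comp_section {φ : M → N} {x : M} (hφ : MDifferentiableAt I I' φ x)
    {Y : (y : N) → TangentSpace I' y}
    (hY : MDifferentiableAt I' (I'.prod 𝓘(ℝ, E')) (fun y ↦ TotalSpace.mk' E' y (Y y)) (φ x)) :
    MDifferentiableAt I (I'.prod 𝓘(ℝ, E')) (fun p ↦ TotalSpace.mk' E' (φ p) (Y (φ p))) x :=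
  MDifferentiableAt.comp x hY hφ

theorem mdifferentiableAt_verticalField {φ : M → N} (hφ : ContMDiff I I' ∞ φ) {x : M}
    (hsub : Function.Surjective (mfderiv I I' φ x)) (u : TangentSpace I x) :
    MDifferentiableAt I (I.prod 𝓘(ℝ, E))
      (fun p ↦ TotalSpace.mk' E p (verticalField I I' φ u p)) x := by
  have hu := mdifferentiableAt_coordField I u
  suffices h : MDifferentiableAt I (I.prod 𝓘(ℝ, E))
      (fun p ↦ TotalSpace.mk' E p ((verticalSpace I I' φ p)ᗮ.starProjection (coordField I u p))) x by
    refine (mdifferentiableAt_sub_section hu h).congr_of_eventuallyEq (.of_forall fun p ↦ ?_)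
    change TotalSpace.mk' E p _ = TotalSpace.mk' E p _
    congr 1
    exact eq_sub_of_add_eq
      ((verticalSpace I I' φ p).starProjection_add_starProjection_orthogonal (coordField I u p))
  let b := Module.finBasis ℝ (TangentSpace I' (φ x))
  have hφx : MDifferentiableAt I I' φ x := hφ.mdifferentiableAt (by simp)
  have hZ i : MDifferentiableAt I (I.prod 𝓘(ℝ, E)) (fun p ↦ TotalSpace.mk' E p
      (adjointDifferential I I' φ p (coordField I' (b i) (φ p)))) x :=
    mdifferentiableAt_adjointDifferential hφ
      (mdifferentiableAt_comp_section hφx (mdifferentiableAt_coordField I' (b i)))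
  refine mdifferentiableAt_of_inner (I := I) (F := E) (V := fun p : M ↦ TangentSpace I p) hZ ?_ ?_ ?_
  · simp_rw [coordField_self]
    exact b.linearIndependent.map' _ (LinearMap.ker_eq_bot.2 (injective_adjointDifferential hsub))
  · filter_upwards [hφx.continuousAt.preimage_mem_nhds
      ((trivializationAt E' (TangentSpace I') (φ x)).open_baseSet.mem_nhds
      (FiberBundle.mem_baseSet_trivializationAt' (φ x)))] with p hp
    have hm := Submodule.starProjection_apply_mem (verticalSpace I I' φ p)ᗮ (coordField I u p)
    obtain ⟨w, hw⟩ := LinearMap.mem_range.1 ((range_adjointDifferential φ p).ge hm)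
    rw [← hw, eq_sum_coordField I' hp b w, map_sum]
    refine Submodule.sum_mem _ fun i _ ↦ ?_
    rw [map_smul]
    exact Submodule.smul_mem _ _ (Submodule.subset_span ⟨i, rfl⟩)
  · intro i
    have h (p : M) : inner ℝ (adjointDifferential I I' φ p (coordField I' (b i) (φ p)))
        ((verticalSpace I I' φ p)ᗮ.starProjection (coordField I u p)) =
        inner ℝ (adjointDifferential I I' φ p (coordField I' (b i) (φ p))) (coordField I u p) := by
      rw [← Submodule.inner_starProjection_left_eq_right, Submodule.starProjection_eq_self_iff.2]
      rw [← range_adjointDifferential]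
      exact LinearMap.mem_range_self _ _
    simp_rw [h]
    exact MDifferentiableAt.inner_bundle (F := E) (E := fun p : M ↦ TangentSpace I p) (hZ i) hu

end Differentiability

section Along

set_option linter.unusedSectionVars false

variable {E : Type*} [NormedAddCommGroup E] [NormedSpace ℝ E] [FiniteDimensional ℝ E]
  {H : Type*} [TopologicalSpace H] {I : ModelWithCorners ℝ E H}
  {M : Type*} [TopologicalSpace M] [ChartedSpace H M] [IsManifold I ∞ M]
  {E' : Type*} [NormedAddCommGroup E'] [NormedSpace ℝ E'] [FiniteDimensional ℝ E']
  {H' : Type*} [TopologicalSpace H'] {I' : ModelWithCorners ℝ E' H'}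
  {N : Type*} [TopologicalSpace N] [ChartedSpace H' N] [IsManifold I' ∞ N]
  [RiemannianBundle (fun y : N ↦ TangentSpace I' y)]
  [IsContMDiffRiemannianBundle I' ∞ E' (fun y : N ↦ TangentSpace I' y)]

theorem covDerivAlong_congr {φ : M → N} {S S' : (p : M) → TangentSpace I' (φ p)} {x : M}
    (h : ∀ᶠ p in nhds x, S p = S' p) (v : TangentSpace I x) :
    covDerivAlong I I' φ S x v = covDerivAlong I I' φ S' x v := by
  have h' : (fun p ↦ toCoord I' (φ x) (S p)) =ᶠ[nhds x] fun p ↦ toCoord I' (φ x) (S' p) :=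
    h.mono fun p hp ↦ by simp only [hp]
  rw [covDerivAlong, covDerivAlong, mvfderiv, mvfderiv, h'.mfderiv_eq, h.self_of_nhds]

theorem covDerivAlong_add {φ : M → N} {S S' : (p : M) → TangentSpace I' (φ p)} {x : M}
    (hS : MDifferentiableAt I 𝓘(ℝ, E') (fun p ↦ toCoord I' (φ x) (S p)) x)
    (hS' : MDifferentiableAt I 𝓘(ℝ, E') (fun p ↦ toCoord I' (φ x) (S' p)) x)
    (v : TangentSpace I x) :
    covDerivAlong I I' φ (fun p ↦ S p + S' p) x v =
      covDerivAlong I I' φ S x v + covDerivAlong I I' φ S' x v := by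
  have h : (fun p ↦ toCoord I' (φ x) (S p + S' p)) =
      (fun p ↦ toCoord I' (φ x) (S p)) + fun p ↦ toCoord I' (φ x) (S' p) := by
    ext1 p
    simp only [toCoord, Pi.add_apply, map_add]
  rw [covDerivAlong, h, mvfderiv_add hS hS', christoffel_add_right, covDerivAlong, covDerivAlong,
    _root_.add_apply, ofCoord, map_add]
  simp only [ofCoord]
  abel

theorem covDerivAlong_smul {φ : M → N} {f : M → ℝ} {S : (p : M) → TangentSpace I' (φ p)} {x : M}
    (hf : MDifferentiableAt I 𝓘(ℝ) f x)
    (hS : MDifferentiableAt I 𝓘(ℝ, E') (fun p ↦ toCoord I' (φ x) (S p)) x)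
    (v : TangentSpace I x) :
    covDerivAlong I I' φ (fun p ↦ f p • S p) x v =
      f x • covDerivAlong I I' φ S x v + mvfderiv I f x v • S x := by
  have h : (fun p ↦ toCoord I' (φ x) (f p • S p)) = f • fun p ↦ toCoord I' (φ x) (S p) := by
    ext1 p
    simp only [toCoord, Pi.smul_apply', map_smul]
  have e := ofCoord_toCoord I' (FiberBundle.mem_baseSet_trivializationAt' (φ x)) (S x)
  rw [ofCoord] at e
  rw [covDerivAlong, h, mvfderiv_smul hf hS,
    christoffel_smul_right, covDerivAlong]
  simp only [ofCoord, _root_.add_apply, _root_.smul_apply, ContinuousLinearMap.smulRight_apply,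
    map_add, map_smul, e, smul_add]
  abel

theorem covDerivAlong_zero {φ : M → N} {x : M} (v : TangentSpace I x) :
    covDerivAlong I I' φ (fun _ ↦ 0) x v = 0 := by
  have h : (fun p : M ↦ toCoord I' (φ x) (0 : TangentSpace I' (φ p))) = fun _ ↦ 0 := by
    ext1 p
    simp only [toCoord, map_zero]
  have h0 := christoffel_smul_right I' 0 (mfderiv I I' φ x v) 0
  rw [zero_smul, zero_smul] at h0
  rw [covDerivAlong, h, mvfderiv_const, h0]
  simp [ofCoord, -Bundle.Trivialization.symmL_apply]

theorem covDerivAlong_sum_smul {ι : Type*} (s : Finset ι) {φ : M → N} {f : ι → M → ℝ}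
    {S : ι → (p : M) → TangentSpace I' (φ p)} {x : M}
    (hf : ∀ i, MDifferentiableAt I 𝓘(ℝ) (f i) x)
    (hS : ∀ i, MDifferentiableAt I 𝓘(ℝ, E') (fun p ↦ toCoord I' (φ x) (S i p)) x)
    (v : TangentSpace I x) :
    covDerivAlong I I' φ (fun p ↦ ∑ i ∈ s, f i p • S i p) x v =
      ∑ i ∈ s, (f i x • covDerivAlong I I' φ (S i) x v + mvfderiv I (f i) x v • S i x) := by
  classical
  have hd (i) : MDifferentiableAt I 𝓘(ℝ, E') (fun p ↦ toCoord I' (φ x) (f i p • S i p)) x := by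
    simp only [toCoord, map_smul]
    exact (hf i).smul (hS i)
  suffices h : MDifferentiableAt I 𝓘(ℝ, E')
      (fun p ↦ toCoord I' (φ x) (∑ i ∈ s, f i p • S i p)) x ∧
      covDerivAlong I I' φ (fun p ↦ ∑ i ∈ s, f i p • S i p) x v =
        ∑ i ∈ s, (f i x • covDerivAlong I I' φ (S i) x v + mvfderiv I (f i) x v • S i x) from h.2
  induction s using Finset.induction_on with
  | empty =>
    simp only [Finset.sum_empty, covDerivAlong_zero, toCoord, map_zero, and_true]
    exact mdifferentiableAt_const
  | insert i s hi ih =>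
    simp only [Finset.sum_insert hi]
    refine ⟨?_, ?_⟩
    · refine ((hd i).add ih.1).congr_of_eventuallyEq (.of_forall fun p ↦ ?_)
      simp only [toCoord, Pi.add_apply, map_add]
    · rw [covDerivAlong_add (hd i) ih.1, covDerivAlong_smul (hf i) (hS i), ih.2]

variable [RiemannianBundle (fun x : M ↦ TangentSpace I x)]
  [IsContMDiffRiemannianBundle I ∞ E (fun x : M ↦ TangentSpace I x)] in
/-- A parallel complex structure commutes with the pull-back connection. -/
theorem IsKahler.covDerivAlong_map {J : (y : N) → TangentSpace I' y →L[ℝ] TangentSpace I' y}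
    (hJ : IsKahler I' J) {φ : M → N} {S : (p : M) → TangentSpace I' (φ p)} {x : M}
    (hφ : MDifferentiableAt I I' φ x)
    (hS : MDifferentiableAt I 𝓘(ℝ, E') (fun p ↦ toCoord I' (φ x) (S p)) x)
    (v : TangentSpace I x) :
    covDerivAlong I I' φ (fun p ↦ J (φ p) (S p)) x v = J (φ x) (covDerivAlong I I' φ S x v) := by
  let t := trivializationAt E' (TangentSpace I' : N → Type _) (φ x)
  have ht : φ x ∈ t.baseSet := FiberBundle.mem_baseSet_trivializationAt' (φ x)
  let b := Module.finBasis ℝ (TangentSpace I' (φ x))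
  let L i : E' →L[ℝ] ℝ := (LinearMap.toContinuousLinearMap (b.coord i)).comp (t.symmL ℝ (φ x))
  let f i (p : M) : ℝ := L i (toCoord I' (φ x) (S p))
  have hf i : MDifferentiableAt I 𝓘(ℝ) (f i) x :=
    (L i).differentiableAt.mdifferentiableAt.comp x hS
  have hev : ∀ᶠ p in nhds x, S p = ∑ i, f i p • coordField I' (b i) (φ p) := by
    filter_upwards [hφ.continuousAt.preimage_mem_nhds (t.open_baseSet.mem_nhds ht)] with p hp
    exact eq_sum_coordField I' hp b (S p)
  have hev' : ∀ᶠ p in nhds x, J (φ p) (S p) =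
      ∑ i, f i p • J (φ p) (coordField I' (b i) (φ p)) := by
    filter_upwards [hev] with p hp
    conv_lhs => rw [hp]
    simp only [map_sum, map_smul]
  have hb i := mdifferentiableAt_coordField I' (b i)
  have hJb i : MDifferentiableAt I' (I'.prod 𝓘(ℝ, E'))
      (fun y ↦ TotalSpace.mk' E' y (J y (coordField I' (b i) y))) (φ x) :=
    MDifferentiableAt.clm_bundle_apply (F₁ := E') (E₁ := fun y : N ↦ TangentSpace I' y) (b := id)
      (hJ.smooth.mdifferentiableAt (by simp)) (hb i)
  rw [covDerivAlong_congr hev, covDerivAlong_congr hev',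
    covDerivAlong_sum_smul _ hf
      (fun i ↦ mdifferentiableAt_toCoord_along (mdifferentiableAt_comp_section hφ (hb i))),
    covDerivAlong_sum_smul _ hf
      (fun i ↦ mdifferentiableAt_toCoord_along (mdifferentiableAt_comp_section hφ (hJb i))),
    map_sum]
  refine Finset.sum_congr rfl fun i _ ↦ ?_
  rw [covDerivAlong_comp I I' hφ (hb i), covDerivAlong_comp I I' hφ (hJb i), map_add, map_smul,
    map_smul, hJ.parallel (φ x) t.baseSet t.open_baseSet ht _ (contMDiffOn_coordField I' (b i))]

end Along

section SecondFundamentalForm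

set_option linter.unusedSectionVars false

variable {E : Type*} [NormedAddCommGroup E] [NormedSpace ℝ E] [FiniteDimensional ℝ E]
  {H : Type*} [TopologicalSpace H] {I : ModelWithCorners ℝ E H}
  {M : Type*} [TopologicalSpace M] [ChartedSpace H M] [IsManifold I ∞ M]
  {E' : Type*} [NormedAddCommGroup E'] [NormedSpace ℝ E'] [FiniteDimensional ℝ E']
  {H' : Type*} [TopologicalSpace H'] {I' : ModelWithCorners ℝ E' H'}
  {N : Type*} [TopologicalSpace N] [ChartedSpace H' N] [IsManifold I' ∞ N]

/-- In the preferred charts, the derivative of `dφ` is the second derivative of `φ`. -/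
theorem mvfderiv_toCoord_mfderiv_coordField [I.Boundaryless] {φ : M → N} (hφ : ContMDiff I I' ∞ φ)
    {x : M} (v w : TangentSpace I x) :
    mvfderiv I (fun p ↦ toCoord I' (φ x) (mfderiv I I' φ p (coordField I w p))) x v =
      fderiv ℝ (fderiv ℝ (extChartAt I' (φ x) ∘ φ ∘ (extChartAt I x).symm)) (extChartAt I x x)
        (toCoord I x v) (toCoord I x w) := by
  set F : E → E' := extChartAt I' (φ x) ∘ φ ∘ (extChartAt I x).symm with hF
  have hFs : ContDiffAt ℝ ∞ F (extChartAt I x x) := by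
    have := (contMDiffAt_iff.1 (hφ x)).2
    rwa [I.range_eq_univ, contDiffWithinAt_univ] at this
  have hev : (fun p ↦ toCoord I' (φ x) (mfderiv I I' φ p (coordField I w p))) =ᶠ[nhds x]
      fun p ↦ fderiv ℝ F (extChartAt I x p) (toCoord I x w) := by
    filter_upwards [(chartAt H x).open_source.mem_nhds (mem_chart_source H x),
      hφ.continuous.continuousAt.preimage_mem_nhds
        ((chartAt H' (φ x)).open_source.mem_nhds (mem_chart_source H' (φ x)))] with p hp hp'
    have hp2 : p ∈ (extChartAt I x).source := by rwa [extChartAt_source]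
    have h1 : HasMFDerivAt 𝓘(ℝ, E) I (extChartAt I x).symm (extChartAt I x p)
        (mfderivWithin 𝓘(ℝ, E) I (extChartAt I x).symm (Set.range I) (extChartAt I x p)) := by
      have := (mdifferentiableWithinAt_extChartAt_symm (I := I)
        ((extChartAt I x).map_source hp2)).hasMFDerivWithinAt
      rw [← hasMFDerivWithinAt_univ]
      convert this
      exact I.range_eq_univ.symm
    have h2 : HasMFDerivAt I I' φ ((extChartAt I x).symm (extChartAt I x p))
        (mfderiv I I' φ p : E →L[ℝ] E') := by
      rw [(extChartAt I x).left_inv hp2]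
      exact (hφ.mdifferentiableAt (by simp)).hasMFDerivAt
    have h3 : HasMFDerivAt I' 𝓘(ℝ, E') (extChartAt I' (φ x))
        (φ ((extChartAt I x).symm (extChartAt I x p)))
        (mfderiv I' 𝓘(ℝ, E') (extChartAt I' (φ x)) (φ p) : E' →L[ℝ] E') := by
      rw [(extChartAt I x).left_inv hp2]
      exact (mdifferentiableAt_extChartAt hp').hasMFDerivAt
    have h4 := (HasMFDerivAt.comp (extChartAt I x p) h3
      (HasMFDerivAt.comp (extChartAt I x p) h2 h1)).mfderiv
    rw [mfderiv_eq_fderiv] at h4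
    rw [hF, toCoord, coordField, ofCoord, TangentBundle.continuousLinearMapAt_trivializationAt hp',
      TangentBundle.symmL_trivializationAt hp]
    exact (congrArg (fun L : E →L[ℝ] E' ↦ L (toCoord I x w)) h4).symm
  have hd : DifferentiableAt ℝ (fun u ↦ fderiv ℝ F u (toCoord I x w)) (extChartAt I x x) :=
    ((hFs.fderiv_right (m := 1) (WithTop.coe_le_coe.2 le_top)).differentiableAt one_ne_zero).clm_apply
      (differentiableAt_const _)
  have he : MDifferentiableAt I 𝓘(ℝ, E) (extChartAt I x) x :=
    mdifferentiableAt_extChartAt (mem_chart_source H x)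
  have h5 : mfderiv I 𝓘(ℝ, E') (fun p ↦ fderiv ℝ F (extChartAt I x p) (toCoord I x w)) x v =
      fderiv ℝ (fun u ↦ fderiv ℝ F u (toCoord I x w)) (extChartAt I x x)
        (mfderiv I 𝓘(ℝ, E) (extChartAt I x) x v) := by
    have h := mfderiv_comp_apply x hd.mdifferentiableAt he v
    rwa [mfderiv_eq_fderiv] at h
  have h6 : fderiv ℝ (fun u ↦ fderiv ℝ F u (toCoord I x w)) (extChartAt I x x) (toCoord I x v) =
      fderiv ℝ (fderiv ℝ F) (extChartAt I x x) (toCoord I x v) (toCoord I x w) := by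
    rw [fderiv_clm_apply ((hFs.fderiv_right (m := 1) (WithTop.coe_le_coe.2 le_top)).differentiableAt
      one_ne_zero) (differentiableAt_const _)]
    simp
  have h7 : mfderiv I 𝓘(ℝ, E) (extChartAt I x) x v = toCoord I x v := by
    rw [toCoord, TangentBundle.continuousLinearMapAt_trivializationAt (mem_chart_source H x)]
    rfl
  rw [mvfderiv, hev.mfderiv_eq, ← h6]
  exact h5.trans (congrArg _ h7)

theorem mvfderiv_toCoord_mfderiv_coordField_comm [I.Boundaryless] {φ : M → N}
    (hφ : ContMDiff I I' ∞ φ) {x : M} (v w : TangentSpace I x) :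
    mvfderiv I (fun p ↦ toCoord I' (φ x) (mfderiv I I' φ p (coordField I w p))) x v =
      mvfderiv I (fun p ↦ toCoord I' (φ x) (mfderiv I I' φ p (coordField I v p))) x w := by
  rw [mvfderiv_toCoord_mfderiv_coordField hφ, mvfderiv_toCoord_mfderiv_coordField hφ]
  have hFs := (contMDiffAt_iff.1 (hφ x)).2
  rw [I.range_eq_univ, contDiffWithinAt_univ] at hFs
  exact hFs.isSymmSndFDerivAt (by
    rw [minSmoothness_of_isRCLikeNormedField]
    exact WithTop.coe_le_coe.2 le_top) _ _

variable [RiemannianBundle (fun x : M ↦ TangentSpace I x)]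
  [IsContMDiffRiemannianBundle I ∞ E (fun x : M ↦ TangentSpace I x)]
  [RiemannianBundle (fun y : N ↦ TangentSpace I' y)]
  [IsContMDiffRiemannianBundle I' ∞ E' (fun y : N ↦ TangentSpace I' y)]

/-- The second fundamental form of a map may be computed with any extension of its second
argument. -/
theorem secondFundamentalForm_eq {φ : M → N} (hφ : ContMDiff I I' ∞ φ) {x : M}
    {W : (p : M) → TangentSpace I p}
    (hW : MDifferentiableAt I (I.prod 𝓘(ℝ, E)) (fun p ↦ TotalSpace.mk' E p (W p)) x)
    (v : TangentSpace I x) :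
    secondFundamentalForm I I' φ x v (W x) =
      covDerivAlong I I' φ (fun p ↦ mfderiv I I' φ p (W p)) x v
        - mfderiv I I' φ x (leviCivita I W x v) := by
  let Φ (W : (p : M) → TangentSpace I p) : TangentSpace I' (φ x) :=
    covDerivAlong I I' φ (fun p ↦ mfderiv I I' φ p (W p)) x v
        - mfderiv I I' φ x (leviCivita I W x v)
  have hΦ : TensorialAt I E Φ x :=
    { smul := fun {f W} hf hW ↦ by
        have h1 := covDerivAlong_smul hf
          (mdifferentiableAt_toCoord_along (mdifferentiableAt_mfderiv_apply hφ hW)) v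
        have h2 := congrArg (fun L ↦ L v)
          ((leviCivita I (M := M)).isCovariantDerivativeOnUniv.leibniz hW hf (Set.mem_univ x))
        simp only [Φ, Pi.smul_apply', map_smul]
        rw [h1]
        erw [h2]
        simp [smul_sub]
      add := fun {W W'} hW hW' ↦ by
        have h1 := covDerivAlong_add
          (mdifferentiableAt_toCoord_along (mdifferentiableAt_mfderiv_apply hφ hW))
          (mdifferentiableAt_toCoord_along (mdifferentiableAt_mfderiv_apply hφ hW')) v
        have h2 := congrArg (fun L ↦ L v)
          ((leviCivita I (M := M)).isCovariantDerivativeOnUniv.add hW hW' (Set.mem_univ x))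
        simp only [Φ, Pi.add_apply, map_add]
        rw [h1]
        erw [h2]
        simp
        abel }
  exact hΦ.pointwise (mdifferentiableAt_coordField I (W x)) hW (coordField_self I (W x))

theorem secondFundamentalForm_comm [I.Boundaryless] {φ : M → N} (hφ : ContMDiff I I' ∞ φ) {x : M}
    (v w : TangentSpace I x) :
    secondFundamentalForm I I' φ x v w = secondFundamentalForm I I' φ x w v := by
  rw [secondFundamentalForm, secondFundamentalForm, covDerivAlong, covDerivAlong,
    leviCivita_coordField, leviCivita_coordField, christoffel_comm I v w, coordField_self,
    coordField_self, christoffel_comm I' (mfderiv I I' φ x v),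
    mvfderiv_toCoord_mfderiv_coordField_comm hφ]

theorem secondFundamentalForm_add_right {φ : M → N} (hφ : ContMDiff I I' ∞ φ) {x : M}
    (v w w' : TangentSpace I x) :
    secondFundamentalForm I I' φ x v (w + w') =
      secondFundamentalForm I I' φ x v w + secondFundamentalForm I I' φ x v w' := by
  have h := covDerivAlong_add
    (mdifferentiableAt_toCoord_along
      (mdifferentiableAt_mfderiv_apply hφ (mdifferentiableAt_coordField I w)))
    (mdifferentiableAt_toCoord_along
      (mdifferentiableAt_mfderiv_apply hφ (mdifferentiableAt_coordField I w'))) v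
  rw [secondFundamentalForm, secondFundamentalForm, secondFundamentalForm, leviCivita_coordField,
    leviCivita_coordField, leviCivita_coordField, christoffel_add_right]
  simp only [map_add, coordField_add, Pi.add_apply, h]
  abel

theorem secondFundamentalForm_smul_right {φ : M → N} (hφ : ContMDiff I I' ∞ φ) {x : M}
    (r : ℝ) (v w : TangentSpace I x) :
    secondFundamentalForm I I' φ x v (r • w) = r • secondFundamentalForm I I' φ x v w := by
  have h := covDerivAlong_smul (mdifferentiableAt_const (c := r))
    (mdifferentiableAt_toCoord_along
      (mdifferentiableAt_mfderiv_apply hφ (mdifferentiableAt_coordField I w))) v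
  rw [mvfderiv_const] at h
  rw [secondFundamentalForm, secondFundamentalForm, leviCivita_coordField,
    leviCivita_coordField, christoffel_smul_right]
  simp only [map_smul, coordField_smul, Pi.smul_apply, h]
  simp [smul_sub]

/-- The second fundamental form of a map as a bilinear map. -/
def secondFundamentalFormBilin [I.Boundaryless] {φ : M → N} (hφ : ContMDiff I I' ∞ φ) (x : M) :
    TangentSpace I x →ₗ[ℝ] TangentSpace I x →ₗ[ℝ] TangentSpace I' (φ x) :=
  LinearMap.mk₂ ℝ (secondFundamentalForm I I' φ x)
    (fun v v' w ↦ by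
      rw [secondFundamentalForm_comm hφ, secondFundamentalForm_add_right hφ,
        secondFundamentalForm_comm hφ w, secondFundamentalForm_comm hφ w])
    (fun r v w ↦ by
      rw [secondFundamentalForm_comm hφ, secondFundamentalForm_smul_right hφ,
        secondFundamentalForm_comm hφ w])
    (secondFundamentalForm_add_right hφ) (secondFundamentalForm_smul_right hφ)

end SecondFundamentalForm

section Submersions

set_option linter.unusedSectionVars false

variable {E : Type*} [NormedAddCommGroup E] [NormedSpace ℝ E] [FiniteDimensional ℝ E]
  {H : Type*} [TopologicalSpace H] {I : ModelWithCorners ℝ E H}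
  {M : Type*} [TopologicalSpace M] [ChartedSpace H M] [IsManifold I ∞ M]
  [RiemannianBundle (fun x : M ↦ TangentSpace I x)]
  [IsContMDiffRiemannianBundle I ∞ E (fun x : M ↦ TangentSpace I x)]
  {E' : Type*} [NormedAddCommGroup E'] [NormedSpace ℝ E'] [FiniteDimensional ℝ E']
  {H' : Type*} [TopologicalSpace H'] {I' : ModelWithCorners ℝ E' H'}
  {N : Type*} [TopologicalSpace N] [ChartedSpace H' N] [IsManifold I' ∞ N]
  [RiemannianBundle (fun y : N ↦ TangentSpace I' y)]
  [IsContMDiffRiemannianBundle I' ∞ E' (fun y : N ↦ TangentSpace I' y)]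
  {J : (y : N) → TangentSpace I' y →L[ℝ] TangentSpace I' y} {φ : M → N}

/-- For a pseudo-horizontally homothetic map, `∇dφ` is complex linear with respect to the complex
structure which `dφ^*` transports to the horizontal space. -/
theorem secondFundamentalForm_adjointDifferential_map (hJ : IsKahler I' J)
    (hφ : ContMDiff I I' ∞ φ) (hPHH : ∀ x, IsPHHAt I I' J φ x) {x : M} {v : TangentSpace I x}
    (hv : v ∈ (verticalSpace I I' φ x)ᗮ) (w : TangentSpace I' (φ x)) :
    secondFundamentalForm I I' φ x v (adjointDifferential I I' φ x (J (φ x) w)) =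
      J (φ x) (secondFundamentalForm I I' φ x v (adjointDifferential I I' φ x w)) := by
  have hφx : MDifferentiableAt I I' φ x := hφ.mdifferentiableAt (by simp)
  have hY := mdifferentiableAt_coordField I' w
  have hJY : MDifferentiableAt I' (I'.prod 𝓘(ℝ, E'))
      (fun y ↦ TotalSpace.mk' E' y (J y (coordField I' w y))) (φ x) :=
    MDifferentiableAt.clm_bundle_apply (F₁ := E') (E₁ := fun y : N ↦ TangentSpace I' y) (b := id)
      (hJ.smooth.mdifferentiableAt (by simp)) hY
  have hA := mdifferentiableAt_adjointDifferential hφ (mdifferentiableAt_comp_section hφx hY)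
  have hAJ := mdifferentiableAt_adjointDifferential hφ (mdifferentiableAt_comp_section hφx hJY)
  have h1 := secondFundamentalForm_eq hφ hA v
  have h2 := secondFundamentalForm_eq hφ hAJ v
  have h3 := (hPHH x).2 v hv _
    (trivializationAt E' (TangentSpace I' : N → Type _) (φ x)).open_baseSet
    (FiberBundle.mem_baseSet_trivializationAt' (φ x)) _ (contMDiffOn_coordField I' w)
  have h4 : (fun p ↦ mfderiv I I' φ p
      (adjointDifferential I I' φ p (J (φ p) (coordField I' w (φ p))))) =
      fun p ↦ J (φ p) (mfderiv I I' φ p (adjointDifferential I I' φ p (coordField I' w (φ p)))) :=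
    funext fun p ↦ (hPHH p).1 _
  rw [h3, h4, hJ.covDerivAlong_map hφx
    (mdifferentiableAt_toCoord_along (mdifferentiableAt_mfderiv_apply hφ hA)), ← map_sub, ← h1] at h2
  simpa only [coordField_self] using h2

/-- The trace of `∇dφ` over the horizontal space of a pseudo-horizontally homothetic submersion
vanishes. -/
theorem sum_secondFundamentalForm_horizontal [I.Boundaryless] (hJ : IsKahler I' J)
    (hφ : ContMDiff I I' ∞ φ) (hPHH : ∀ x, IsPHHAt I I' J φ x) {x : M} {ι : Type*} [Fintype ι]
    (f : OrthonormalBasis ι ℝ (verticalSpace I I' φ x)ᗮ) :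
    ∑ j, secondFundamentalForm I I' φ x (f j) (f j) = 0 := by
  have hh (w : TangentSpace I' (φ x)) :
      adjointDifferential I I' φ x w ∈ (verticalSpace I I' φ x)ᗮ :=
    (range_adjointDifferential φ x).le (LinearMap.mem_range_self _ w)
  refine sum_bilin_eq_zero (secondFundamentalFormBilin hφ x) _ f (adjointDifferential I I' φ x)
    (range_adjointDifferential φ x) (J (φ x)) (fun y z ↦ ?_) (fun y ↦ ?_)
  · rw [inner_adjointDifferential, inner_adjointDifferential, (hPHH x).1, hJ.inner_map]
  · change secondFundamentalForm I I' φ x _ _ = -secondFundamentalForm I I' φ x _ _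
    rw [secondFundamentalForm_adjointDifferential_map hJ hφ hPHH (hh _),
      secondFundamentalForm_comm hφ,
      secondFundamentalForm_adjointDifferential_map hJ hφ hPHH (hh _), hJ.sq]

/-- On vertical vectors, `∇dφ` is `-dφ` of the second fundamental form of the fibre. -/
theorem mfderiv_fibreSecondFundamentalForm (hφ : ContMDiff I I' ∞ φ) {x : M}
    (hsub : Function.Surjective (mfderiv I I' φ x)) (u w : verticalSpace I I' φ x) :
    mfderiv I I' φ x (fibreSecondFundamentalForm I I' φ x u w) =
      -secondFundamentalForm I I' φ x u w := by
  have hW := mdifferentiableAt_verticalField hφ hsub (w : TangentSpace I x)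
  have hWx : verticalField I I' φ (w : TangentSpace I x) x = w := by
    rw [verticalField, coordField_self, Submodule.starProjection_eq_self_iff.2 w.2]
  have h0 : (fun p ↦ mfderiv I I' φ p (verticalField I I' φ (w : TangentSpace I x) p)) =
      fun _ ↦ 0 :=
    funext fun p ↦ LinearMap.mem_ker.1
      (Submodule.starProjection_apply_mem (verticalSpace I I' φ p) _)
  have h1 := secondFundamentalForm_eq hφ hW (u : TangentSpace I x)
  rw [hWx, h0, covDerivAlong_zero, zero_sub] at h1
  rw [h1, neg_neg]
  set a := leviCivita I (verticalField I I' φ (w : TangentSpace I x)) x (u : TangentSpace I x) with ha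
  have h2 := (verticalSpace I I' φ x).starProjection_add_starProjection_orthogonal a
  have h3 : mfderiv I I' φ x ((verticalSpace I I' φ x).starProjection a) = 0 :=
    LinearMap.mem_ker.1 (Submodule.starProjection_apply_mem (verticalSpace I I' φ x) a)
  conv_rhs => rw [← h2, map_add, h3, zero_add]
  rfl

theorem tensionField_eq [I.Boundaryless] (hJ : IsKahler I' J) (hφ : ContMDiff I I' ∞ φ)
    (hPHH : ∀ x, IsPHHAt I I' J φ x) {x : M} (hsub : Function.Surjective (mfderiv I I' φ x)) :
    tensionField I I' φ x =
      -mfderiv I I' φ x (∑ i, fibreSecondFundamentalForm I I' φ x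
        (stdOrthonormalBasis ℝ (verticalSpace I I' φ x) i)
        (stdOrthonormalBasis ℝ (verticalSpace I I' φ x) i)) := by
  have h := sum_bilin_eq_add (secondFundamentalFormBilin hφ x)
    (stdOrthonormalBasis ℝ (TangentSpace I x)) (verticalSpace I I' φ x)
    (stdOrthonormalBasis ℝ (verticalSpace I I' φ x))
    (stdOrthonormalBasis ℝ (verticalSpace I I' φ x)ᗮ)
  have h0 := sum_secondFundamentalForm_horizontal hJ hφ hPHH
    (stdOrthonormalBasis ℝ (verticalSpace I I' φ x)ᗮ)
  rw [map_sum, ← Finset.sum_neg_distrib]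
  simp_rw [mfderiv_fibreSecondFundamentalForm hφ hsub, neg_neg]
  exact h.trans ((congrArg _ h0).trans (add_zero _))

end Submersions

end RiemannianGeometry

end

theorem theorem3p6 (m n : ℕ) (hn : 2 ≤ n)
    {M : Type*} [TopologicalSpace M] [ChartedSpace (EuclideanSpace ℝ (Fin m)) M]
    [IsManifold (𝓡 m) ∞ M] [RiemannianBundle (fun x : M ↦ TangentSpace (𝓡 m) x)]
    [IsContMDiffRiemannianBundle (𝓡 m) ∞ (EuclideanSpace ℝ (Fin m))
      (fun x : M ↦ TangentSpace (𝓡 m) x)]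
    {N : Type*} [TopologicalSpace N] [ChartedSpace (EuclideanSpace ℝ (Fin (2 * n))) N]
    [IsManifold (𝓡 (2 * n)) ∞ N] [RiemannianBundle (fun y : N ↦ TangentSpace (𝓡 (2 * n)) y)]
    [IsContMDiffRiemannianBundle (𝓡 (2 * n)) ∞ (EuclideanSpace ℝ (Fin (2 * n)))
      (fun y : N ↦ TangentSpace (𝓡 (2 * n)) y)]
    (J : (y : N) → TangentSpace (𝓡 (2 * n)) y →L[ℝ] TangentSpace (𝓡 (2 * n)) y)
    (hJ : RiemannianGeometry.IsKahler (𝓡 (2 * n)) J)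
    (V : (x : M) → TangentSpace (𝓡 m) x)
    (hV : ContMDiff (𝓡 m) ((𝓡 m).prod 𝓘(ℝ, EuclideanSpace ℝ (Fin m))) ∞
      (fun x ↦ TotalSpace.mk' (EuclideanSpace ℝ (Fin m)) x (V x)))
    (φ : M → N) (hφ : ContMDiff (𝓡 m) (𝓡 (2 * n)) ∞ φ)
    (hsub : ∀ x, Function.Surjective (mfderiv (𝓡 m) (𝓡 (2 * n)) φ x))
    (hPHH : ∀ x, RiemannianGeometry.IsPHHAt (𝓡 m) (𝓡 (2 * n)) J φ x) :
    RiemannianGeometry.IsVHarmonic (𝓡 m) (𝓡 (2 * n)) V φ ↔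
      ∀ y, RiemannianGeometry.IsVMinimalFibre (𝓡 m) (𝓡 (2 * n)) V φ y := by
  have key (x : M) := RiemannianGeometry.tensionField_eq hJ hφ hPHH (hsub x)
  have h (x : M) :
      (RiemannianGeometry.tensionField (𝓡 m) (𝓡 (2 * n)) φ x +
        mfderiv (𝓡 m) (𝓡 (2 * n)) φ x (V x) = 0) ↔
      ∑ i, RiemannianGeometry.fibreSecondFundamentalForm (𝓡 m) (𝓡 (2 * n)) φ x
        (stdOrthonormalBasis ℝ (RiemannianGeometry.verticalSpace (𝓡 m) (𝓡 (2 * n)) φ x) i)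
        (stdOrthonormalBasis ℝ (RiemannianGeometry.verticalSpace (𝓡 m) (𝓡 (2 * n)) φ x) i) - V x ∈
          RiemannianGeometry.verticalSpace (𝓡 m) (𝓡 (2 * n)) φ x := by
    refine Iff.trans ?_ LinearMap.mem_ker.symm
    rw [key, neg_add_eq_zero, ContinuousLinearMap.coe_coe, map_sub, sub_eq_zero]
  exact ⟨fun hV' _ x _ ↦ (h x).1 (hV' x), fun hM x ↦ (h x).2 (hM (φ x) x rfl)⟩
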